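/- Let $G$ be a finite connected plane graph (loops and multiple edges are allowed), with two distinct special vertices $s_0,s_1$ on the boundary of its outer face. An \emph{angle} of $G$ is a corner of a face at a vertex, between two cyclically consecutive edge-ends at that vertex. A \emph{weak labeling} of $G$ is a map from the angles of $G$ to $\{0,1\}$ such that (G0) for $i\in\{0,1\}$, all angles at $s_i$ are labeled $i$; (G1) for each vertex $v\notin\{s_0,s_1\}$, the labels around $v$, in cyclic order, form a non-empty interval of $1$s and a non-empty interval of $0$s; (G2) for each edge, the two incident labels coincide at one end and differ at the other; (G3) for each face, including the outer one, the labels along its boundary walk, in cyclic order, form a non-empty interval of $1$s and a non-empty interval of $0$s. A \emph{2-orientation} of $G$ is an orientation of its edges in which every vertex other than $s_0,s_1$ has outdegree two. Fix an angle $c_i$ of the outer face at $s_i$ for $i=0,1$ (if $s_i$ occurs only once on the outer boundary walk there is no choice). The angles $c_0,c_1$ divide the boundary walk of the outer face into two arcs $A_0,A_1$. The \emph{split dual} $G^*_s$ is obtained from the dual graph $G^*$ by splitting the vertex of the outer face into two vertices $o^*_0,o^*_1$, where $o^*_i$ keeps the incidences with the dual edges of $A_i$. A \emph{$2^*$-orientation}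 is an orientation of the edges of $G^*_s$ in which $o^*_0$ and $o^*_1$ have outdegree one and every other vertex has outdegree two. For a weak labeling $\phi$, let $X_\phi$ be the orientation of $G$ that directs each edge towards the endpoint at which its two labels coincide, and let $X^*_\phi$ be the orientation of $G^*_s$ that directs each dual edge towards the side on which the two labels incident to the primal edge (one at each of its ends) coincide. Then $\phi\mapsto(X_\phi,X^*_\phi)$ is a bijection from the set of weak labelings of $G$ onto the set of pairs $(X,X^*)$ where $X$ is a 2-orientation of $G$ and $X^*$ is a $2^*$-orientation of $G^*_s$. -/

import Mathlib

/-- A finite multigraph (loops and parallel edges allowed) presented by its darts.  An edge is an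
unordered pair `{d, rev d}` of opposite darts, and `tail d` is the vertex that the dart `d`
leaves. -/
structure DartGraph (D V : Type*) where
  /-- the same edge, traversed in the opposite direction -/
  rev : Equiv.Perm D
  rev_rev : ∀ d, rev (rev d) = d
  rev_ne : ∀ d, rev d ≠ d
  /-- the vertex from which a dart starts -/
  tail : D → V

namespace DartGraph

variable {D V : Type*} (G : DartGraph D V)

/-- An orientation chooses exactly one of the two darts of every edge. The edge is directed along
the chosen dart. -/
def IsOrientation (X : Set D) : Prop :=
  ∀ d, d ∈ X ↔ G.rev d ∉ X

/-- The number of edges that are directed away from `v`. -/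
noncomputable def outdeg (X : Set D) (v : V) : ℕ :=
  {d | d ∈ X ∧ G.tail d = v}.ncard

end DartGraph

/-- A finite connected plane graph with at least one edge, presented combinatorially as a planar
map: the counterclockwise cyclic order of the darts around each vertex, with Euler
characteristic two. -/
structure PlaneGraph (D : Type*) [Finite D] where
  /-- the next dart, in counterclockwise order, that leaves the same vertex -/
  rot : Equiv.Perm D
  /-- the same edge, traversed in the opposite direction -/
  rev : Equiv.Perm D
  rev_rev : ∀ d, rev (rev d) = d
  rev_ne : ∀ d, rev d ≠ d
  /-- the graph is connected -/
  connected : ∀ d d' : D, ∃ g ∈ Subgroup.closure {rot, rev}, g d = d'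
  /-- the embedding has genus zero: (vertices) - (edges) + (faces) = 2, where a face boundary is
  walked with the face to the left by following a dart `d` and then leaving its head along
  `rot⁻¹ (rev d)` -/
  euler : (Nat.card (Quotient (Equiv.Perm.SameCycle.setoid rot)) : ℤ)
      - Nat.card (Quotient (Equiv.Perm.SameCycle.setoid rev))
      + Nat.card (Quotient (Equiv.Perm.SameCycle.setoid (rot⁻¹ * rev))) = 2

namespace PlaneGraph

variable {D : Type*} [Finite D] (G : PlaneGraph D)

/-- The successor of a dart on the boundary walk of the face to its left. -/
def faceNext : Equiv.Perm D := G.rot⁻¹ * G.rev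

/-- Vertices are the cycles of `rot`. -/
abbrev Vertex : Type _ := Quotient (Equiv.Perm.SameCycle.setoid G.rot)

/-- Faces are the cycles of `faceNext`. -/
abbrev Face : Type _ := Quotient (Equiv.Perm.SameCycle.setoid G.faceNext)

/-- The vertex that a dart leaves. -/
def tail (d : D) : G.Vertex := Quotient.mk _ d

/-- The face to the left of a dart. -/
def left (d : D) : G.Face := Quotient.mk _ d

/-- The underlying graph. -/
def graph : DartGraph D G.Vertex where
  rev := G.rev
  rev_rev := G.rev_rev
  rev_ne := G.rev_ne
  tail := G.tail

/-!
Angles are indexed by darts: the angle `d` lies at the vertex `G.tail d`, in the face `G.left d`,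
between the dart `d` and the next dart `G.rot d`.  Consequently

* `G.rot` is the cyclic order of the angles around a vertex, and `G.faceNext` is the cyclic order
  of the angles along a face;
* the two angles at `G.tail d` incident to the edge of `d` are `d` (to the left of the dart `d`)
  and `G.rot⁻¹ d` (to its right);
* the two angles in the face `G.left d` incident to the edge of `d` are `d` (at the tail of `d`)
  and `G.faceNext d` (at the head of `d`).
-/

/-- Along the cycle of `p` through `d`, the labels form a non-empty interval of `1`s followed by a
non-empty interval of `0`s. -/
def TwoIntervals (p : Equiv.Perm D) (φ : D → Fin 2) (d : D) : Prop :=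
  ∃ a, p.SameCycle d a ∧ ∃ k m : ℕ, 0 < k ∧ 0 < m ∧ k + m = Function.minimalPeriod p a ∧
    (∀ i < k, φ ((p ^ i) a) = 1) ∧ (∀ i < m, φ ((p ^ (k + i)) a) = 0)

/-- The two labels at `G.tail d` incident to the edge of `d` coincide. -/
def CoincideAtTail (φ : D → Fin 2) (d : D) : Prop :=
  φ d = φ (G.rot⁻¹ d)

/-- The two labels in the face `G.left d` incident to the edge of `d` coincide. -/
def CoincideAtLeft (φ : D → Fin 2) (d : D) : Prop :=
  φ d = φ (G.faceNext d)

/-- Weak labelings of a plane graph with special vertices `s₀` and `s₁`. -/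
structure IsWeakLabeling (s₀ s₁ : G.Vertex) (φ : D → Fin 2) : Prop where
  special₀ : ∀ d, G.tail d = s₀ → φ d = 0
  special₁ : ∀ d, G.tail d = s₁ → φ d = 1
  vertex_rule : ∀ d, G.tail d ≠ s₀ → G.tail d ≠ s₁ → TwoIntervals G.rot φ d
  /-- the labels coincide at exactly one of the two ends of each edge -/
  edge_rule : ∀ d, Xor (G.CoincideAtTail φ d) (G.CoincideAtTail φ (G.rev d))
  face_rule : ∀ d, TwoIntervals G.faceNext φ d

/-- A 2-orientation: every vertex other than `s₀`, `s₁` has outdegree two. -/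
structure IsTwoOrientation (s₀ s₁ : G.Vertex) (X : Set D) : Prop where
  orientation : G.graph.IsOrientation X
  outdeg_eq : ∀ v, v ≠ s₀ → v ≠ s₁ → G.graph.outdeg X v = 2

/-- The darts on the boundary walk of a face that are traversed when walking from the angle `a`
until the angle `b` is reached. -/
def arc (a b : D) : Set D :=
  {d | ∃ i : ℕ, d = (G.faceNext ^ i) a ∧ ∀ j ≤ i, (G.faceNext ^ j) a ≠ b}

/-- Vertices of the split dual: the faces other than the outer one, and two vertices
`o 0`, `o 1` that replace the outer face. -/
inductive SplitDualVertex (outer : G.Face) : Type _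
  | inner (f : G.Face) (hf : f ≠ outer)
  | o (i : Fin 2)

open Classical in
/-- The split dual, for the arcs of the outer face between the outer angles `c₀` and `c₁`.  The
dual dart of `d` crosses `d` from the face on the left of `d` to the face on its right, the
reverse of the dual dart is the dual dart of the reverse, and the vertex `o 0` keeps the incidences
with the arc from `c₀` to `c₁`, while `o 1` keeps those with the other arc. -/
noncomputable def splitDual (outer : G.Face) (c₀ c₁ : D) :
    DartGraph D (G.SplitDualVertex outer) where
  rev := G.rev
  rev_rev := G.rev_rev
  rev_ne := G.rev_ne
  tail d :=
    if h : G.left d = outer then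
      if d ∈ G.arc c₀ c₁ then .o 0 else .o 1
    else .inner (G.left d) h

/-- A `2*`-orientation of the split dual: outdegree one at the two copies of the outer face, and
outdegree two at every other vertex. -/
structure IsTwoStarOrientation (outer : G.Face) (c₀ c₁ : D) (Y : Set D) : Prop where
  orientation : (G.splitDual outer c₀ c₁).IsOrientation Y
  outdeg_o : ∀ i, (G.splitDual outer c₀ c₁).outdeg Y (.o i) = 1
  outdeg_inner : ∀ f hf, (G.splitDual outer c₀ c₁).outdeg Y (.inner f hf) = 2

/-- The orientation induced by a labeling: each edge is directed towards the endpoint at which its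
two labels coincide. -/
def inducedOrientation (φ : D → Fin 2) : Set D :=
  {d | G.CoincideAtTail φ (G.rev d)}

/-- The orientation of the (split) dual induced by a labeling: each dual edge is directed towards
the face in which its two labels coincide. -/
def inducedDualOrientation (φ : D → Fin 2) : Set D :=
  {d | G.CoincideAtLeft φ (G.rev d)}

end PlaneGraph

/-! ### Label changes along a cycle -/

section Cyclic

variable {D : Type*} [Finite D]

/-! A labeling is encoded by its places of change. For a weak labeling, `X` consists of the darts
across which the label changes around the tail, and `Y` of those along which it changes in the left
face. A cyclic 0-1 word is two non-empty intervals iff it has exactly two changes, so (G1) and (G3)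
become outdegree conditions, while (G2) makes both sets orientations. On the arc from `c₀` to `c₁`
the labels go from 0 to 1, so the number of changes there is odd and at most two, hence one.
Connectedness gives injectivity, since the changes and one label determine all labels.

For surjectivity, Euler's formula forces outdegree zero at both special vertices
(`outdeg_special_eq_zero`), so all prescribed change counts are even. The angles are the 0-cells of
a cell structure on the sphere whose 2-cells are the vertices, faces and edges of `G`; its first
cohomology mod 2 vanishes (`ker_totalDiff_eq_range_labelDiff`), so some labeling has these changes.
Normalized to 0 at `c₀`, it is 0 around `s₀`, and the single change on the arc makes it 1 around
`s₁`. -/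

theorem PlaneGraph.TwoIntervals.ncard_changes {p : Equiv.Perm D} {φ : D → Fin 2} {d : D}
    (h : PlaneGraph.TwoIntervals p φ d) :
    {x | φ x ≠ φ (p x) ∧ p.SameCycle d x}.ncard = 2 := by
  obtain ⟨a, hda, k, m, hk, hm, hkm, h1, h0⟩ := h
  set n := Function.minimalPeriod p a with hn
  have hpn : (p ^ n) a = a := by
    have := Function.iterate_minimalPeriod (f := p) (x := a)
    rwa [← Equiv.Perm.coe_pow] at this
  have hinj : ∀ i < n, ∀ j < n, (p ^ i) a = (p ^ j) a → i = j := by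
    intro i hi j hj hij
    rw [Equiv.Perm.coe_pow, Equiv.Perm.coe_pow] at hij
    exact (Function.iterate_eq_iterate_iff_of_lt_minimalPeriod hi hj).1 hij
  have hsucc : ∀ i, p ((p ^ i) a) = (p ^ (i + 1)) a := fun i => by
    rw [pow_succ', Equiv.Perm.mul_apply]
  have h0' : ∀ i, k ≤ i → i < n → φ ((p ^ i) a) = 0 := fun i hi hin => by
    have := h0 (i - k) (by omega)
    rwa [Nat.add_sub_cancel' hi] at this
  have hset : {x | φ x ≠ φ (p x) ∧ p.SameCycle d x} = {(p ^ (k - 1)) a, (p ^ (n - 1)) a} := by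
    ext x
    simp only [Set.mem_ofPred_eq, Set.mem_insert_iff, Set.mem_singleton_iff]
    constructor
    · rintro ⟨hne, hdx⟩
      obtain ⟨j, hj⟩ := (hda.symm.trans hdx).exists_nat_pow_eq
      have hjn : (p ^ (j % n)) a = x := by
        rw [← hj, Equiv.Perm.coe_pow, Equiv.Perm.coe_pow, Function.iterate_mod_minimalPeriod_eq]
      have hlt : j % n < n := Nat.mod_lt _ (by omega)
      generalize j % n = i at hjn hlt
      subst hjn
      rw [hsucc] at hne
      by_cases h1i : i = k - 1
      · exact Or.inl (by rw [h1i])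
      by_cases h2i : i = n - 1
      · exact Or.inr (by rw [h2i])
      exfalso
      apply hne
      by_cases hik : i < k
      · rw [h1 i hik, h1 (i + 1) (by omega)]
      · rw [h0' i (by omega) hlt, h0' (i + 1) (by omega) (by omega)]
    · have hsame : ∀ i : ℕ, p.SameCycle d ((p ^ i) a) := fun i =>
        hda.trans ⟨i, by simp⟩
      rintro (rfl | rfl)
      · refine ⟨?_, hsame _⟩
        rw [hsucc, h1 _ (by omega), h0' _ (by omega) (by omega)]
        decide
      · refine ⟨?_, hsame _⟩
        rw [hsucc, h0' _ (by omega) (by omega), Nat.sub_add_cancel (by omega), hpn]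
        have := h1 0 hk
        rw [pow_zero, Equiv.Perm.one_apply] at this
        rw [this]
        decide
  rw [hset, Set.ncard_pair]
  intro h
  have := hinj _ (by omega) _ (by omega) h
  omega

/-- Start just after a change from 0 to 1 and take the maximal run of 1s. A second run of 1s would
create a third change. -/
theorem PlaneGraph.twoIntervals_of_ncard_changes {p : Equiv.Perm D} {φ : D → Fin 2} {d : D}
    (h : {x | φ x ≠ φ (p x) ∧ p.SameCycle d x}.ncard = 2) :
    PlaneGraph.TwoIntervals p φ d := by
  classical
  have hsucc : ∀ (i : ℕ) a, p ((p ^ i) a) = (p ^ (i + 1)) a := fun i a => by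
    rw [pow_succ', Equiv.Perm.mul_apply]
  have hone : ∀ z : Fin 2, z ≠ 0 → z = 1 := by decide
  have hzero : ∀ z : Fin 2, z ≠ 1 → z = 0 := by decide
  have hper : ∀ a, 0 < Function.minimalPeriod p a := fun a =>
    Function.minimalPeriod_pos_of_mem_periodicPts
      ((Function.Injective.mem_periodicPts p.injective) a)
  have hpn : ∀ a, (p ^ (Function.minimalPeriod p a)) a = a := fun a => by
    rw [Equiv.Perm.coe_pow]
    exact Function.iterate_minimalPeriod
  have hlast : ∀ a, (p ^ (Function.minimalPeriod p (p a) - 1)) (p a) = a := fun a => by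
    apply p.injective
    rw [hsucc, Nat.sub_add_cancel (hper _), hpn]
  -- If the known change goes from 1 to 0, walk on to the first 1. The step into it is a change from
  -- 0 to 1.
  obtain ⟨x, hx, hdx, hx0⟩ : ∃ x, φ x ≠ φ (p x) ∧ p.SameCycle d x ∧ φ x = 0 := by
    obtain ⟨c, hc, hdc⟩ : {x | φ x ≠ φ (p x) ∧ p.SameCycle d x}.Nonempty := by
      rw [← Set.ncard_pos]
      omega
    by_cases hc0 : φ c = 0
    · exact ⟨c, hc, hdc, hc0⟩
    have hc1 := hone _ hc0
    have hex : ∃ j, φ ((p ^ j) (p c)) = 1 := ⟨_, by rw [hlast c, hc1]⟩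
    have hj := Nat.find_spec hex
    have hmin := fun {m} => Nat.find_min (m := m) hex
    generalize Nat.find hex = j at hj hmin
    have hj0 : j ≠ 0 := by
      rintro rfl
      rw [pow_zero, Equiv.Perm.one_apply] at hj
      exact hc (hc1.trans hj.symm)
    have hprev := hzero _ (hmin (m := j - 1) (by omega))
    refine ⟨(p ^ (j - 1)) (p c), ?_, ?_, hprev⟩
    · rw [hsucc, Nat.sub_add_cancel (by omega), hj, hprev]
      decide
    · exact hdc.trans ⟨((j - 1 + 1 : ℕ) : ℤ), by
        rw [zpow_natCast, pow_succ, Equiv.Perm.mul_apply]⟩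
  set a := p x with ha
  set n := Function.minimalPeriod p a with hn
  have hn0 : 0 < n := hper a
  have ha1 : φ a = 1 := hone _ fun h => hx (hx0.trans h.symm)
  have hda : p.SameCycle d a := hdx.trans ⟨1, by simp [ha]⟩
  have hxa : (p ^ (n - 1)) a = x := hlast x
  have hex : ∃ k, φ ((p ^ k) a) = 0 := ⟨n - 1, by rw [hxa, hx0]⟩
  have hk := Nat.find_spec hex
  have hmin := fun {m} => Nat.find_min (m := m) hex
  have hkn : Nat.find hex ≤ n - 1 := Nat.find_min' hex (by rw [hxa, hx0])
  generalize Nat.find hex = k at hk hmin hkn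
  have hk0 : k ≠ 0 := by
    rintro rfl
    rw [pow_zero, Equiv.Perm.one_apply, ha1] at hk
    exact absurd hk (by decide)
  have hinj : ∀ i < n, ∀ j < n, (p ^ i) a = (p ^ j) a → i = j := by
    intro i hi j hj hij
    rw [Equiv.Perm.coe_pow, Equiv.Perm.coe_pow] at hij
    exact (Function.iterate_eq_iterate_iff_of_lt_minimalPeriod hi hj).1 hij
  have hmem : ∀ i, φ ((p ^ i) a) ≠ φ ((p ^ (i + 1)) a) →
      (p ^ i) a ∈ {x | φ x ≠ φ (p x) ∧ p.SameCycle d x} := fun i hi =>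
    ⟨by rwa [hsucc], hda.trans ⟨i, by simp⟩⟩
  -- A 1 after the zeros have begun would give three distinct changes: the end of the first run, the
  -- step into this 1, and the step closing the cycle.
  have hzeros : ∀ i, k + i < n → φ ((p ^ (k + i)) a) = 0 := by
    intro i
    induction i with
    | zero => intro _; exact hk
    | succ i ih =>
      intro hi
      by_contra hne
      have h1 := hmem (k - 1) (by
        rw [Nat.sub_add_cancel (by omega), hk]
        exact hmin (by omega))
      have h2 := hmem (k + i) (by
        rw [ih (by omega)]
        exact fun h => hne h.symm)
      have h3 := hmem (n - 1) (by
        rw [Nat.sub_add_cancel (by omega), hpn, hxa, hx0, ha1]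
        decide)
      have hsub : ({(p ^ (k - 1)) a, (p ^ (k + i)) a, (p ^ (n - 1)) a} : Set D) ⊆
          {x | φ x ≠ φ (p x) ∧ p.SameCycle d x} := by
        rintro y (rfl | rfl | rfl)
        exacts [h1, h2, h3]
      have hcard := Set.ncard_le_ncard hsub
      have h3card : ({(p ^ (k - 1)) a, (p ^ (k + i)) a, (p ^ (n - 1)) a} : Set D).ncard = 3 := by
        rw [Set.ncard_eq_three]
        refine ⟨_, _, _, ?_, ?_, ?_, rfl⟩ <;> intro h
        · have := hinj _ (by omega) _ (by omega) h
          omega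
        · have := hinj _ (by omega) _ (by omega) h
          omega
        · have := hinj _ (by omega) _ (by omega) h
          omega
      omega
  exact ⟨a, hda, k, n - k, by omega, by omega, by omega,
    fun i hi => hone _ (hmin hi), fun i hi => hzeros i (by omega)⟩

end Cyclic

/-! ### Mod 2 sums over fibers -/

section FiberSum

variable {D Q : Type*} [Fintype D] [DecidableEq Q]

/-- Summation over the fibers of a map. -/
def fiberSum (π : D → Q) : (D → ZMod 2) →ₗ[ZMod 2] (Q → ZMod 2) where
  toFun x q := ∑ d with π d = q, x d
  map_add' x y := by
    ext q
    simp [Finset.sum_add_distrib]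
  map_smul' c x := by
    ext q
    simp [Finset.mul_sum]

theorem fiberSum_apply (π : D → Q) (x : D → ZMod 2) (q : Q) :
    fiberSum π x q = ∑ d with π d = q, x d := rfl

theorem fiberSum_comp_perm (π : D → Q) (σ : Equiv.Perm D) (hσ : ∀ d, π (σ d) = π d)
    (x : D → ZMod 2) : fiberSum π (fun d => x (σ d)) = fiberSum π x := by
  ext q
  rw [fiberSum_apply, fiberSum_apply]
  refine Finset.sum_equiv σ (fun d => ?_) (fun _ _ => rfl)
  simp [hσ]

theorem fiberSum_single [DecidableEq D] (π : D → Q) (d : D) :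
    fiberSum π (Pi.single d 1) = Pi.single (π d) 1 := by
  ext q
  rw [fiberSum_apply, Finset.sum_filter]
  simp only [Pi.single_apply]
  rw [Finset.sum_eq_single d]
  · simp [eq_comm]
  · intro b _ hb
    simp [hb]
  · simp

theorem fiberSum_indicator (π : D → Q) (S : Set D) (q : Q) :
    fiberSum π (S.indicator 1) q = ({d | d ∈ S ∧ π d = q}.ncard : ZMod 2) := by
  classical
  rw [fiberSum_apply, Finset.sum_indicator_eq_sum_filter, Set.ncard_eq_toFinset_card']
  simp only [Pi.one_apply, Finset.sum_const, nsmul_eq_mul, mul_one]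
  congr 2
  ext d
  simp [and_comm]

end FiberSum

/-! ### Vertices, faces and edges as cycles of darts -/

namespace PlaneGraph

variable {D : Type*} [Finite D] (G : PlaneGraph D)

/-- Edges are the cycles of `rev`. -/
abbrev Edge : Type _ := Quotient (Equiv.Perm.SameCycle.setoid G.rev)

/-- The edge of a dart. -/
def edge (d : D) : G.Edge := Quotient.mk _ d

theorem tail_rot (d : D) : G.tail (G.rot d) = G.tail d :=
  Quotient.sound (Equiv.Perm.SameCycle.symm ⟨1, by simp⟩)

theorem tail_rot_inv (d : D) : G.tail (G.rot⁻¹ d) = G.tail d := by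
  rw [← G.tail_rot, Equiv.Perm.inv_def, Equiv.apply_symm_apply]

theorem left_faceNext (d : D) : G.left (G.faceNext d) = G.left d :=
  Quotient.sound (Equiv.Perm.SameCycle.symm ⟨1, by simp⟩)

theorem edge_rev (d : D) : G.edge (G.rev d) = G.edge d :=
  Quotient.sound (Equiv.Perm.SameCycle.symm ⟨1, by simp⟩)

theorem faceNext_apply (d : D) : G.faceNext d = G.rot⁻¹ (G.rev d) := rfl

theorem faceNext_rev (d : D) : G.faceNext (G.rev d) = G.rot⁻¹ d := by
  rw [faceNext_apply, G.rev_rev]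

theorem tail_eq_iff {d e : D} : G.tail d = G.tail e ↔ G.rot.SameCycle d e :=
  Quotient.eq

theorem left_eq_iff {d e : D} : G.left d = G.left e ↔ G.faceNext.SameCycle d e :=
  Quotient.eq

theorem edge_eq_iff {d e : D} : G.edge d = G.edge e ↔ e = d ∨ e = G.rev d := by
  constructor
  · intro h
    obtain ⟨n, hn⟩ : G.rev.SameCycle d e := Quotient.eq.1 h
    have h2 : G.rev ^ (2 : ℤ) = 1 := by
      ext x
      simp [zpow_ofNat, pow_two, G.rev_rev]
    rcases Int.even_or_odd' n with ⟨k, rfl | rfl⟩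
    · rw [zpow_mul, h2, one_zpow] at hn
      exact Or.inl hn.symm
    · rw [zpow_add, zpow_mul, h2, one_zpow, one_mul, zpow_one] at hn
      exact Or.inr hn.symm
  · rintro (rfl | rfl)
    · rfl
    · exact (G.edge_rev d).symm

/-- A function on darts that is invariant under `rot` and `rev` is constant. -/
theorem eq_of_rot_rev {α : Type*} (f : D → α) (hrot : ∀ d, f (G.rot d) = f d)
    (hrev : ∀ d, f (G.rev d) = f d) (d e : D) : f d = f e := by
  obtain ⟨g, hg, rfl⟩ := G.connected d e
  suffices ∀ d, f (g d) = f d from (this d).symm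
  induction hg using Subgroup.closure_induction with
  | mem x hx =>
    rcases hx with rfl | rfl
    exacts [hrot, hrev]
  | one => exact fun _ => rfl
  | mul x y _ _ hx hy => exact fun d => by rw [Equiv.Perm.mul_apply, hx, hy]
  | inv x _ hx => exact fun d => by rw [← hx (x⁻¹ d), Equiv.Perm.inv_def, Equiv.apply_symm_apply]

theorem two_mul_card_edge : 2 * Nat.card G.Edge = Nat.card D := by
  classical
  have := Fintype.ofFinite D
  rw [Nat.card_eq_fintype_card, Nat.card_eq_fintype_card, ← Finset.card_univ (α := D),
    Finset.card_eq_sum_card_fiberwise (f := G.edge) (t := Finset.univ) (by simp)]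
  rw [Finset.sum_const_nat (m := 2), Finset.card_univ, mul_comm]
  intro q _
  induction q using Quotient.inductionOn with
  | h d =>
    change (Finset.univ.filter fun e => G.edge e = G.edge d).card = 2
    have : (Finset.univ.filter fun e => G.edge e = G.edge d) = {d, G.rev d} := by
      ext e
      rw [Finset.mem_filter, eq_comm (a := G.edge e), G.edge_eq_iff]
      simp
    rw [this, Finset.card_pair (G.rev_ne d).symm]

/-! ### Mod 2 cohomology of the angle complex -/

section Cohomology

/-- Differences of a labeling around vertices and along faces. -/
def labelDiff : (D → ZMod 2) →ₗ[ZMod 2] (D → ZMod 2) × (D → ZMod 2) where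
  toFun φ := (fun d => φ d - φ (G.rot⁻¹ d), fun d => φ d - φ (G.faceNext d))
  map_add' φ ψ := by
    ext d <;> simp <;> ring
  map_smul' c φ := by
    ext d <;> simp <;> ring

/-- A labeling without differences is invariant under `rot` and `rev`, hence constant by
connectedness. -/
theorem finrank_ker_labelDiff_le (c : D) :
    Module.finrank (ZMod 2) (LinearMap.ker G.labelDiff) ≤ 1 := by
  have hinj : Function.Injective
      ((LinearMap.proj c : (D → ZMod 2) →ₗ[ZMod 2] ZMod 2).comp
        (LinearMap.ker G.labelDiff).subtype) := by
    rw [← LinearMap.ker_eq_bot, LinearMap.ker_eq_bot']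
    rintro ⟨φ, hφ⟩ h
    have hφ' := LinearMap.mem_ker.1 hφ
    have hr : ∀ d, φ d - φ (G.rot⁻¹ d) = 0 := fun d => congrFun (congrArg Prod.fst hφ') d
    have hf : ∀ d, φ d - φ (G.faceNext d) = 0 := fun d => congrFun (congrArg Prod.snd hφ') d
    have hrot : ∀ d, φ (G.rot d) = φ d := fun d => by
      have := sub_eq_zero.1 (hr (G.rot d))
      rwa [Equiv.Perm.inv_def, Equiv.symm_apply_apply] at this
    have hrev : ∀ d, φ (G.rev d) = φ d := fun d => by
      have := sub_eq_zero.1 (hf d)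
      rw [this, faceNext_apply, sub_eq_zero.1 (hr (G.rev d))]
    ext d
    exact (G.eq_of_rot_rev φ hrot hrev d c).trans h
  have := LinearMap.finrank_le_finrank_of_injective hinj
  rwa [Module.finrank_self] at this

variable [Fintype D]

open Classical in
/-- Total differences around vertices, faces and edges. -/
noncomputable def totalDiff : (D → ZMod 2) × (D → ZMod 2) →ₗ[ZMod 2]
    (G.Vertex → ZMod 2) × (G.Face → ZMod 2) × (G.Edge → ZMod 2) :=
  ((fiberSum G.tail).comp (LinearMap.fst _ _ _)).prod
    (((fiberSum G.left).comp (LinearMap.snd _ _ _)).prod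
      ((fiberSum G.edge).comp (LinearMap.fst _ _ _ + LinearMap.snd _ _ _)))

open Classical in
theorem totalDiff_apply (x y : D → ZMod 2) :
    G.totalDiff (x, y) = (fiberSum G.tail x, fiberSum G.left y, fiberSum G.edge (x + y)) := rfl

/-- Around a vertex or a face the differences telescope. Around an edge, the four angles form a
quadrilateral whose sides are the four differences. -/
theorem totalDiff_labelDiff (φ : D → ZMod 2) : G.totalDiff (G.labelDiff φ) = 0 := by
  classical
  have h : G.labelDiff φ = (φ - fun d => φ (G.rot⁻¹ d), φ - fun d => φ (G.faceNext d)) := rfl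
  have h1 := fiberSum_comp_perm G.tail G.rot⁻¹ G.tail_rot_inv φ
  have h2 := fiberSum_comp_perm G.left G.faceNext G.left_faceNext φ
  have h3 := fiberSum_comp_perm G.edge G.rev G.edge_rev (fun d => φ (G.rot⁻¹ d))
  rw [h, totalDiff_apply, map_add, map_sub, map_sub, map_sub, map_sub, h1, h2]
  change (_, _, _ - _ + (_ - fiberSum G.edge (fun d => φ (G.rot⁻¹ (G.rev d))))) = _
  rw [h3, sub_self, sub_self]
  refine Prod.ext rfl (Prod.ext rfl ?_)
  ext q
  exact CharTwo.add_self_eq_zero (R := ZMod 2) _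

/-- This bounds the corank of `totalDiff`. A functional killing its range takes equal values on
2-cells sharing a side, so by connectedness one value determines it. -/
theorem finrank_ker_dualMap_totalDiff_le (c : D) :
    Module.finrank (ZMod 2) (LinearMap.ker G.totalDiff.dualMap) ≤ 1 := by
  classical
  have hinj : Function.Injective
      ((Module.Dual.eval (ZMod 2) _
        ((Pi.single (G.tail c) 1, 0, 0) :
          (G.Vertex → ZMod 2) × (G.Face → ZMod 2) × (G.Edge → ZMod 2))).comp
        (LinearMap.ker G.totalDiff.dualMap).subtype) := by
    refine (injective_iff_map_eq_zero _).2 ?_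
    rintro ⟨g, hg⟩ h
    have hg' := LinearMap.mem_ker.1 hg
    have hgx : ∀ x y, g (G.totalDiff (x, y)) = 0 := fun x y => LinearMap.congr_fun hg' (x, y)
    have hV : ∀ d, g (Pi.single (G.tail d) 1, 0, 0) = g (0, 0, Pi.single (G.edge d) 1) := by
      intro d
      have := hgx (Pi.single d 1) 0
      rw [totalDiff_apply, add_zero, map_zero, fiberSum_single, fiberSum_single] at this
      rw [← CharTwo.add_eq_zero, ← map_add]
      simpa using this
    have hF : ∀ d, g (0, Pi.single (G.left d) 1, 0) = g (0, 0, Pi.single (G.edge d) 1) := by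
      intro d
      have := hgx 0 (Pi.single d 1)
      rw [totalDiff_apply, zero_add, map_zero, fiberSum_single, fiberSum_single] at this
      rw [← CharTwo.add_eq_zero, ← map_add]
      simpa using this
    have hc : ∀ d, g (Pi.single (G.tail d) 1, 0, 0) = 0 := by
      intro d
      refine (G.eq_of_rot_rev (fun d => g (Pi.single (G.tail d) 1, 0, 0)) ?_ ?_ d c).trans h
      · intro d
        simp only [G.tail_rot]
      · intro d
        simp only [hV, G.edge_rev]
    have hE : ∀ d, g (0, 0, Pi.single (G.edge d) 1) = 0 := fun d => by rw [← hV, hc]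
    have hF' : ∀ d, g (0, Pi.single (G.left d) 1, 0) = 0 := fun d => by rw [hF, hE]
    ext q
    · induction q using Quotient.inductionOn with
      | h d => exact hc d
    · induction q using Quotient.inductionOn with
      | h d => exact hF' d
    · induction q using Quotient.inductionOn with
      | h d => exact hE d
  have := LinearMap.finrank_le_finrank_of_injective hinj
  rwa [Module.finrank_self] at this

/-- The vanishing of the first cohomology of the sphere, for the cell structure whose vertices are
the angles of `G`. -/
theorem ker_totalDiff_eq_range_labelDiff (c : D) :
    LinearMap.ker G.totalDiff = LinearMap.range G.labelDiff := by
  classical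
  symm
  apply Submodule.eq_of_le_of_finrank_le
  · rintro _ ⟨φ, rfl⟩
    exact G.totalDiff_labelDiff φ
  -- With `V - E + F = 2` and `2E = |D|`, the kernel of `totalDiff` has dimension at most `2|D| - (V
  -- + E + F - 1) = |D| - 1`, which the rank of `labelDiff` attains.
  have h1 := G.labelDiff.finrank_range_add_finrank_ker
  have h2 := G.totalDiff.finrank_range_add_finrank_ker
  have h3 := G.totalDiff.dualMap.finrank_range_add_finrank_ker
  have h4 := G.finrank_ker_labelDiff_le c
  have h5 := G.finrank_ker_dualMap_totalDiff_le c
  have h6 := G.two_mul_card_edge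
  have h7 := G.euler
  rw [LinearMap.finrank_range_dualMap_eq_finrank_range, Subspace.dual_finrank_eq] at h3
  simp only [Module.finrank_prod, Module.finrank_fintype_fun_eq_card] at h1 h2 h3
  change ((Nat.card G.Vertex : ℤ) - Nat.card G.Edge + Nat.card G.Face = 2) at h7
  simp only [Nat.card_eq_fintype_card] at h6 h7
  omega

end Cohomology


/-- Prescribed changes of labels are realized as soon as there is an even number of them around
each vertex and along each face. -/
theorem exists_labeling_of_even (c : D) {X Y : Set D}
    (hX : ∀ d, d ∈ X ↔ G.rev d ∉ X) (hY : ∀ d, d ∈ Y ↔ G.rev d ∉ Y)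
    (hXe : ∀ v, ({d | d ∈ X ∧ G.tail d = v}.ncard : ZMod 2) = 0)
    (hYe : ∀ f, ({d | d ∈ Y ∧ G.left d = f}.ncard : ZMod 2) = 0) :
    ∃ φ : D → Fin 2, φ c = 0 ∧ (∀ d, d ∈ X ↔ φ d ≠ φ (G.rot⁻¹ d)) ∧
      ∀ d, d ∈ Y ↔ φ d ≠ φ (G.faceNext d) := by
  classical
  have := Fintype.ofFinite D
  have hE : fiberSum G.edge (X.indicator 1 + Y.indicator 1) = 0 := by
    ext q
    induction q using Quotient.inductionOn with
    | h d =>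
      have hfib : (Finset.univ.filter fun e => G.edge e = G.edge d) = {d, G.rev d} := by
        ext e
        rw [Finset.mem_filter, eq_comm (a := G.edge e), G.edge_eq_iff]
        simp
      change ∑ e with G.edge e = G.edge d, _ = _
      rw [hfib, Finset.sum_pair (G.rev_ne d).symm]
      -- An orientation contains exactly one dart of each edge, so `X` and `Y` together contribute
      -- `1 + 1 = 0`.
      have hone : ∀ S : Set D, (∀ d, d ∈ S ↔ G.rev d ∉ S) →
          S.indicator (1 : D → ZMod 2) d + S.indicator 1 (G.rev d) = 1 := by
        intro S hS
        by_cases hd : G.rev d ∈ S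
        · rw [Set.indicator_of_notMem (fun h => (hS d).1 h hd), Set.indicator_of_mem hd, zero_add,
            Pi.one_apply]
        · rw [Set.indicator_of_mem ((hS d).2 hd), Set.indicator_of_notMem hd, add_zero,
            Pi.one_apply]
      rw [Pi.add_apply, Pi.add_apply, add_add_add_comm, hone X hX, hone Y hY]
      exact CharTwo.add_self_eq_zero (R := ZMod 2) 1
  have hker : (X.indicator 1, Y.indicator 1) ∈ LinearMap.ker G.totalDiff := by
    rw [LinearMap.mem_ker, totalDiff_apply, hE]
    refine Prod.ext (funext fun v => ?_) (Prod.ext (funext fun f => ?_) rfl)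
    · exact (fiberSum_indicator _ _ _).trans (hXe v)
    · exact (fiberSum_indicator _ _ _).trans (hYe f)
  rw [G.ker_totalDiff_eq_range_labelDiff c] at hker
  obtain ⟨φ, hφ⟩ := hker
  have hφX : ∀ d, φ d - φ (G.rot⁻¹ d) = X.indicator 1 d :=
    fun d => congrFun (congrArg Prod.fst hφ) d
  have hφY : ∀ d, φ d - φ (G.faceNext d) = Y.indicator 1 d :=
    fun d => congrFun (congrArg Prod.snd hφ) d
  -- Subtracting the constant `φ c` normalizes the label at `c` without altering any change; `ZMod
  -- 2` unfolds to `Fin 2`.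
  have hmem : ∀ (S : Set D) (d : D) (a b z : ZMod 2), a - b = S.indicator 1 d →
      (d ∈ S ↔ a - z ≠ b - z) := by
    intro S d a b z h
    rw [Ne, sub_left_inj, ← sub_eq_zero (a := a), h]
    simp
  exact ⟨fun d => φ d - φ c, sub_self _, fun d => hmem X d _ _ _ (hφX d),
    fun d => hmem Y d _ _ _ (hφY d)⟩

/-! ### Interval conditions and arcs as counts of changes -/

theorem ncard_rot_changes (φ : D → Fin 2) (d : D) :
    {x | φ x ≠ φ (G.rot x) ∧ G.rot.SameCycle d x}.ncard =
      {x | φ x ≠ φ (G.rot⁻¹ x) ∧ G.tail x = G.tail d}.ncard := by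
  rw [← Set.ncard_image_of_injective _ G.rot.injective]
  congr 1
  ext x
  simp only [Set.mem_image, Set.mem_ofPred_eq, ← tail_eq_iff]
  constructor
  · rintro ⟨y, ⟨hy, hdy⟩, rfl⟩
    rw [Equiv.Perm.inv_def, Equiv.symm_apply_apply, G.tail_rot]
    exact ⟨hy.symm, hdy.symm⟩
  · rintro ⟨hx, hdx⟩
    refine ⟨G.rot⁻¹ x, ⟨?_, ?_⟩, Equiv.apply_symm_apply _ _⟩
    · rw [Equiv.Perm.inv_def, Equiv.apply_symm_apply]
      exact hx.symm
    · rw [G.tail_rot_inv, hdx]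

theorem twoIntervals_rot_iff (φ : D → Fin 2) (d : D) :
    TwoIntervals G.rot φ d ↔ {x | φ x ≠ φ (G.rot⁻¹ x) ∧ G.tail x = G.tail d}.ncard = 2 := by
  rw [← G.ncard_rot_changes]
  exact ⟨fun h => h.ncard_changes, twoIntervals_of_ncard_changes⟩

theorem twoIntervals_faceNext_iff (φ : D → Fin 2) (d : D) :
    TwoIntervals G.faceNext φ d ↔
      {x | φ x ≠ φ (G.faceNext x) ∧ G.left x = G.left d}.ncard = 2 := by
  simp only [eq_comm (b := G.left d), left_eq_iff]
  exact ⟨fun h => h.ncard_changes, twoIntervals_of_ncard_changes⟩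

theorem left_of_mem_arc {a b d : D} (h : d ∈ G.arc a b) : G.left d = G.left a := by
  obtain ⟨i, rfl, _⟩ := h
  exact (G.left_eq_iff.2 ⟨i, by simp⟩).symm

/-- Telescoping of label differences along an arc of a face. -/
theorem ncard_arc_changes {a b : D} (hab : G.left a = G.left b) (φ : D → ZMod 2) (S : Set D)
    (hS : ∀ d, d ∈ S ↔ φ d ≠ φ (G.faceNext d)) :
    ({d | d ∈ S ∧ d ∈ G.arc a b}.ncard : ZMod 2) = φ a - φ b := by
  classical
  have hex : ∃ k : ℕ, (G.faceNext ^ k) a = b := (G.left_eq_iff.1 hab).exists_nat_pow_eq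
  have hk := Nat.find_spec hex
  have hmin := fun {m} => Nat.find_min (m := m) hex
  generalize Nat.find hex = k at hk hmin
  have harc : {d | d ∈ S ∧ d ∈ G.arc a b} =
      ↑(((Finset.range k).image fun i => (G.faceNext ^ i) a).filter (· ∈ S)) := by
    ext d
    simp only [arc, Set.mem_ofPred_eq, Finset.coe_filter, Finset.mem_image, Finset.mem_range]
    constructor
    · rintro ⟨hd, i, rfl, hi⟩
      exact ⟨⟨i, not_le.1 fun h => hi k h hk, rfl⟩, hd⟩
    · rintro ⟨⟨i, hi, rfl⟩, hd⟩
      exact ⟨hd, i, rfl, fun j hj => hmin (by omega)⟩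
  -- A repetition before step `k` would allow a shortcut reaching `b` earlier, at step `k - j + i`.
  have hlt : ∀ i j, i < j → j < k → (G.faceNext ^ i) a ≠ (G.faceNext ^ j) a := by
    intro i j hij hj h
    apply hmin (m := k - j + i) (by omega)
    rw [pow_add, Equiv.Perm.mul_apply, h, ← Equiv.Perm.mul_apply, ← pow_add,
      Nat.sub_add_cancel hj.le, hk]
  have hinj : Set.InjOn (fun i => (G.faceNext ^ i) a) (Finset.range k : Set ℕ) := by
    intro i hi j hj h
    rw [Finset.coe_range, Set.mem_Iio] at hi hj
    rcases lt_trichotomy i j with hij | hij | hij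
    · exact absurd h (hlt i j hij hj)
    · exact hij
    · exact absurd h.symm (hlt j i hij hi)
  have hdiff : ∀ u v : ZMod 2, (if u ≠ v then 1 else 0) = u - v := by decide
  rw [harc, Set.ncard_coe_finset, Finset.card_filter, Nat.cast_sum, Finset.sum_image hinj]
  have hterm : ∀ i : ℕ, ((if (G.faceNext ^ i) a ∈ S then 1 else 0 : ℕ) : ZMod 2) =
      φ ((G.faceNext ^ i) a) - φ ((G.faceNext ^ (i + 1)) a) := by
    intro i
    rw [pow_succ', Equiv.Perm.mul_apply, ← hdiff]
    simp only [hS]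
    split_ifs <;> simp
  rw [Finset.sum_congr rfl fun i _ => hterm i,
    Finset.sum_range_sub' (fun i => φ ((G.faceNext ^ i) a)), pow_zero, Equiv.Perm.one_apply, hk]

/-- A `2*`-orientation has two dual darts leaving each face, of which exactly one crosses the arc
of the outer face from `c₀` to `c₁`. -/
theorem isTwoStarOrientation_iff {outer : G.Face} {c₀ c₁ : D} (ho : G.left c₀ = outer)
    (Y : Set D) :
    G.IsTwoStarOrientation outer c₀ c₁ Y ↔ (∀ d, d ∈ Y ↔ G.rev d ∉ Y) ∧
      (∀ f, {d | d ∈ Y ∧ G.left d = f}.ncard = 2) ∧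
      {d | d ∈ Y ∧ d ∈ G.arc c₀ c₁}.ncard = 1 := by
  classical
  have hinner : ∀ f hf, (G.splitDual outer c₀ c₁).outdeg Y (.inner f hf) =
      {d | d ∈ Y ∧ G.left d = f}.ncard := by
    intro f hf
    unfold DartGraph.outdeg
    congr 1
    ext d
    simp only [splitDual, Set.mem_ofPred_eq]
    refine and_congr_right fun _ => ?_
    split_ifs with h1 h2
    · simpa [h1] using hf.symm
    · simpa [h1] using hf.symm
    · simp
  have h0 : (G.splitDual outer c₀ c₁).outdeg Y (.o 0) =
      {d | d ∈ Y ∧ d ∈ G.arc c₀ c₁}.ncard := by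
    unfold DartGraph.outdeg
    congr 1
    ext d
    simp only [splitDual, Set.mem_ofPred_eq]
    refine and_congr_right fun _ => ?_
    split_ifs with h1 h2
    · simpa using h2
    · simpa using h2
    · simpa using fun h => h1 ((G.left_of_mem_arc h).trans ho)
  have h1 : (G.splitDual outer c₀ c₁).outdeg Y (.o 1) =
      {d | d ∈ Y ∧ G.left d = outer ∧ d ∉ G.arc c₀ c₁}.ncard := by
    unfold DartGraph.outdeg
    congr 1
    ext d
    simp only [splitDual, Set.mem_ofPred_eq]
    refine and_congr_right fun _ => ?_
    split_ifs with h1 h2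
    · simpa using fun _ => h2
    · simpa using ⟨h1, h2⟩
    · simpa using fun h => absurd h h1
  have hadd : {d | d ∈ Y ∧ G.left d = outer}.ncard =
      {d | d ∈ Y ∧ d ∈ G.arc c₀ c₁}.ncard +
        {d | d ∈ Y ∧ G.left d = outer ∧ d ∉ G.arc c₀ c₁}.ncard := by
    rw [← Set.ncard_union_eq]
    · congr 1
      ext d
      simp only [Set.mem_ofPred_eq, Set.mem_union]
      have : d ∈ G.arc c₀ c₁ → G.left d = outer := fun h => (G.left_of_mem_arc h).trans ho
      tauto
    · rw [Set.disjoint_left]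
      exact fun d hd hd' => hd'.2.2 hd.2
  constructor
  · intro h
    have ho0 := h.outdeg_o 0
    have ho1 := h.outdeg_o 1
    rw [h0] at ho0
    rw [h1] at ho1
    refine ⟨h.orientation, fun f => ?_, ho0⟩
    by_cases hf : f = outer
    · rw [hf, hadd, ho0, ho1]
    · rw [← hinner f hf, h.outdeg_inner]
  · rintro ⟨hor, hface, harc⟩
    refine ⟨hor, fun i => ?_, fun f hf => by rw [hinner, hface]⟩
    have := hface outer
    fin_cases i
    · exact h0.trans harc
    · refine h1.trans ?_
      omega

/-! ### Counting edges with Euler's formula -/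

theorem _root_.sum_ncard_fiber {Q : Type*} [Fintype Q] (π : D → Q) (S : Set D) :
    ∑ q, {d | d ∈ S ∧ π d = q}.ncard = S.ncard := by
  classical
  have := Fintype.ofFinite D
  rw [Set.ncard_eq_toFinset_card' S,
    Finset.card_eq_sum_card_fiberwise (f := π) (t := Finset.univ) (by simp)]
  refine Finset.sum_congr rfl fun q _ => ?_
  rw [Set.ncard_eq_toFinset_card']
  congr 1
  ext d
  simp

theorem two_mul_ncard_orientation {X : Set D} (hX : ∀ d, d ∈ X ↔ G.rev d ∉ X) :
    2 * X.ncard = Nat.card D := by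
  have h : G.rev '' X = Xᶜ := by
    ext d
    rw [Set.mem_compl_iff, hX d, not_not]
    constructor
    · rintro ⟨e, he, rfl⟩
      rwa [G.rev_rev]
    · exact fun h => ⟨_, h, G.rev_rev d⟩
  have h1 := Set.ncard_image_of_injective X G.rev.injective
  have h2 := Set.ncard_add_ncard_compl X
  rw [h] at h1
  omega

/-- By Euler's formula, no edge leaves a special vertex. -/
theorem outdeg_special_eq_zero {s₀ s₁ : G.Vertex} (hs : s₀ ≠ s₁) {X Y : Set D}
    (hX : G.IsTwoOrientation s₀ s₁ X) (hY : ∀ d, d ∈ Y ↔ G.rev d ∉ Y)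
    (hYf : ∀ f, {d | d ∈ Y ∧ G.left d = f}.ncard = 2) :
    G.graph.outdeg X s₀ = 0 ∧ G.graph.outdeg X s₁ = 0 := by
  classical
  have := Fintype.ofFinite G.Vertex
  have := Fintype.ofFinite G.Face
  have hXs := sum_ncard_fiber G.tail X
  have hYs := sum_ncard_fiber G.left Y
  rw [Finset.sum_congr rfl fun f _ => hYf f, Finset.sum_const, Finset.card_univ,
    smul_eq_mul] at hYs
  change ∑ v, G.graph.outdeg X v = _ at hXs
  have hs1 : s₁ ∈ Finset.univ.erase s₀ := by simp [hs.symm]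
  have hcard : ((Finset.univ.erase s₀).erase s₁).card + 2 = Fintype.card G.Vertex := by
    have h1 := Finset.card_erase_add_one hs1
    have h2 := Finset.card_erase_add_one (Finset.mem_univ s₀)
    rw [Finset.card_univ] at h2
    omega
  rw [← Finset.add_sum_erase _ _ (Finset.mem_univ s₀), ← Finset.add_sum_erase _ _ hs1,
    Finset.sum_congr (g := fun _ => 2) rfl, Finset.sum_const, smul_eq_mul] at hXs
  · have h1 := G.two_mul_ncard_orientation hX.orientation
    have h2 := G.two_mul_ncard_orientation hY
    have h3 := G.two_mul_card_edge
    have h4 := G.euler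
    change ((Nat.card G.Vertex : ℤ) - Nat.card G.Edge + Nat.card G.Face = 2) at h4
    rw [Nat.card_eq_fintype_card (α := G.Vertex), Nat.card_eq_fintype_card (α := G.Face)] at h4
    -- Counting gives `E = 2F` and `E = 2(V - 2) + r`, with `r` the total outdegree of the special
    -- vertices. Adding these and using Euler's formula yields `r = 0`.
    omega
  · intro v hv
    simp only [Finset.mem_erase] at hv
    exact hX.outdeg_eq v hv.2.1 hv.1

/-! ### From weak labelings to orientations -/

theorem mem_inducedOrientation_iff {φ : D → Fin 2}
    (h : ∀ d, Xor (G.CoincideAtTail φ d) (G.CoincideAtTail φ (G.rev d))) (d : D) :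
    d ∈ G.inducedOrientation φ ↔ φ d ≠ φ (G.rot⁻¹ d) := by
  have := h d
  simp only [inducedOrientation, Set.mem_ofPred_eq]
  unfold Xor CoincideAtTail at *
  tauto

/-- By the edge rule the four labels at an edge have odd sum, so they also coincide on exactly one
of its two sides. -/
theorem mem_inducedDualOrientation_iff {φ : D → Fin 2}
    (h : ∀ d, Xor (G.CoincideAtTail φ d) (G.CoincideAtTail φ (G.rev d))) (d : D) :
    d ∈ G.inducedDualOrientation φ ↔ φ d ≠ φ (G.faceNext d) := by
  have := h d
  have key : ∀ a b c d : Fin 2, Xor (a = b) (c = d) → (c = b ↔ a ≠ d) := by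
    unfold Xor
    decide
  change φ (G.rev d) = φ (G.faceNext (G.rev d)) ↔ _
  rw [G.faceNext_rev]
  exact key _ _ _ _ this

theorem inducedOrientation_rev {φ : D → Fin 2}
    (h : ∀ d, Xor (G.CoincideAtTail φ d) (G.CoincideAtTail φ (G.rev d))) (d : D) :
    d ∈ G.inducedOrientation φ ↔ G.rev d ∉ G.inducedOrientation φ := by
  rw [G.mem_inducedOrientation_iff h (G.rev d), not_not]
  rfl

theorem inducedDualOrientation_rev {φ : D → Fin 2}
    (h : ∀ d, Xor (G.CoincideAtTail φ d) (G.CoincideAtTail φ (G.rev d))) (d : D) :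
    d ∈ G.inducedDualOrientation φ ↔ G.rev d ∉ G.inducedDualOrientation φ := by
  rw [G.mem_inducedDualOrientation_iff h (G.rev d), not_not]
  rfl

theorem IsWeakLabeling.isTwoOrientation {s₀ s₁ : G.Vertex} {φ : D → Fin 2}
    (h : G.IsWeakLabeling s₀ s₁ φ) : G.IsTwoOrientation s₀ s₁ (G.inducedOrientation φ) := by
  refine ⟨G.inducedOrientation_rev h.edge_rule, fun v h0 h1 => ?_⟩
  induction v using Quotient.inductionOn with
  | h d =>
    have := (G.twoIntervals_rot_iff φ d).1 (h.vertex_rule d h0 h1)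
    simp only [← G.mem_inducedOrientation_iff h.edge_rule] at this
    exact this

theorem IsWeakLabeling.isTwoStarOrientation {s₀ s₁ : G.Vertex} {φ : D → Fin 2}
    (h : G.IsWeakLabeling s₀ s₁ φ) {outer : G.Face} {c₀ c₁ : D}
    (hc₀ : G.tail c₀ = s₀) (hc₁ : G.tail c₁ = s₁)
    (ho₀ : G.left c₀ = outer) (ho₁ : G.left c₁ = outer) :
    G.IsTwoStarOrientation outer c₀ c₁ (G.inducedDualOrientation φ) := by
  have hface : ∀ f, {d | d ∈ G.inducedDualOrientation φ ∧ G.left d = f}.ncard = 2 := by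
    intro f
    induction f using Quotient.inductionOn with
    | h d =>
      have := (G.twoIntervals_faceNext_iff φ d).1 (h.face_rule d)
      simp only [← G.mem_inducedDualOrientation_iff h.edge_rule] at this
      exact this
  refine (G.isTwoStarOrientation_iff ho₀ _).2
    ⟨G.inducedDualOrientation_rev h.edge_rule, hface, ?_⟩
  -- At most two changes by the face rule, and an odd number by telescoping from 0 to 1.
  have hle : {d | d ∈ G.inducedDualOrientation φ ∧ d ∈ G.arc c₀ c₁}.ncard ≤
      {d | d ∈ G.inducedDualOrientation φ ∧ G.left d = outer}.ncard :=
    Set.ncard_le_ncard fun d hd => ⟨hd.1, (G.left_of_mem_arc hd.2).trans ho₀⟩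
  have hodd := G.ncard_arc_changes (ho₀.trans ho₁.symm) φ _
    (G.mem_inducedDualOrientation_iff h.edge_rule)
  rw [hface] at hle
  rw [h.special₀ c₀ hc₀, h.special₁ c₁ hc₁] at hodd
  generalize Set.ncard _ = n at hle hodd
  interval_cases n
  · exact absurd hodd (by decide)
  · rfl
  · exact absurd hodd (by decide)

/-! ### Injectivity and surjectivity -/

/-- A labeling is determined by its orientations and one of its labels. -/
theorem eq_of_changes_iff {φ ψ : D → Fin 2} {c : D} (hc : φ c = ψ c)
    (hrot : ∀ d, φ d ≠ φ (G.rot⁻¹ d) ↔ ψ d ≠ ψ (G.rot⁻¹ d))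
    (hface : ∀ d, φ d ≠ φ (G.faceNext d) ↔ ψ d ≠ ψ (G.faceNext d)) : φ = ψ := by
  -- With two labels, having the same changes means that agreement of `φ` and `ψ` passes between
  -- neighboring angles.
  have key : ∀ a b c d : Fin 2, (a ≠ b ↔ c ≠ d) → (a = c ↔ b = d) := by decide
  have hr : ∀ d, (φ (G.rot d) = ψ (G.rot d)) = (φ d = ψ d) := fun d => by
    have := key _ _ _ _ (hrot (G.rot d))
    rw [Equiv.Perm.inv_def, Equiv.symm_apply_apply] at this
    exact propext this
  have hf : ∀ d, (φ (G.rev d) = ψ (G.rev d)) = (φ d = ψ d) := fun d =>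
    propext ((key _ _ _ _ (hrot (G.rev d))).trans (key _ _ _ _ (hface d)).symm)
  ext1 d
  rw [G.eq_of_rot_rev (fun d => φ d = ψ d) hr hf d c]
  exact hc

/-- Outdegree zero means no change around the vertex; this yields (G0) at the special vertices. -/
theorem eq_of_tail_eq {X : Set D} {φ : D → Fin 2} {v : G.Vertex}
    (hX : ∀ d, d ∈ X ↔ φ d ≠ φ (G.rot⁻¹ d)) (hv : G.graph.outdeg X v = 0) {c d : D}
    (hc : G.tail c = v) (hd : G.tail d = v) : φ d = φ c := by
  have hconst : ∀ e, G.tail e = v → φ e = φ (G.rot⁻¹ e) := by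
    intro e he
    by_contra hne
    have hempty := (Set.ncard_eq_zero).1 hv
    exact Set.eq_empty_iff_forall_notMem.1 hempty e ⟨(hX e).2 hne, he⟩
  obtain ⟨n, rfl⟩ := (G.tail_eq_iff.1 (hc.trans hd.symm)).exists_nat_pow_eq
  clear hd
  induction n with
  | zero => rfl
  | succ n ih =>
    rw [pow_succ', Equiv.Perm.mul_apply, hconst, Equiv.Perm.inv_def, Equiv.symm_apply_apply, ih]
    rw [G.tail_rot, ← hc]
    exact (G.tail_eq_iff.2 ⟨n, by simp⟩).symm

theorem exists_isWeakLabeling {outer : G.Face} {s₀ s₁ : G.Vertex} (hs : s₀ ≠ s₁) {c₀ c₁ : D}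
    (hc₀ : G.tail c₀ = s₀) (hc₁ : G.tail c₁ = s₁)
    (ho₀ : G.left c₀ = outer) (ho₁ : G.left c₁ = outer) {X Y : Set D}
    (hX : G.IsTwoOrientation s₀ s₁ X) (hY : G.IsTwoStarOrientation outer c₀ c₁ Y) :
    ∃ φ, G.IsWeakLabeling s₀ s₁ φ ∧ G.inducedOrientation φ = X ∧
      G.inducedDualOrientation φ = Y := by
  obtain ⟨hYr, hYf, hYa⟩ := (G.isTwoStarOrientation_iff ho₀ Y).1 hY
  have hXr : ∀ d, d ∈ X ↔ G.rev d ∉ X := hX.orientation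
  obtain ⟨hX0, hX1⟩ := G.outdeg_special_eq_zero hs hX hYr hYf
  have hXe : ∀ v, ({d | d ∈ X ∧ G.tail d = v}.ncard : ZMod 2) = 0 := by
    intro v
    change (G.graph.outdeg X v : ZMod 2) = 0
    by_cases h0 : v = s₀
    · rw [h0, hX0, Nat.cast_zero]
    by_cases h1 : v = s₁
    · rw [h1, hX1, Nat.cast_zero]
    rw [hX.outdeg_eq v h0 h1]
    decide
  obtain ⟨φ, hφc, hφX, hφY⟩ := G.exists_labeling_of_even c₀ hXr hYr hXe
    (fun f => by rw [hYf f]; decide)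
  have hedge : ∀ d, Xor (G.CoincideAtTail φ d) (G.CoincideAtTail φ (G.rev d)) := by
    intro d
    have h1 := hφX d
    have h2 := hφX (G.rev d)
    have h3 := hXr d
    unfold Xor CoincideAtTail
    tauto
  -- Outdegree one at `o 0` is exactly what forces the label to flip between `c₀` and `c₁`.
  have hφ1 : φ c₁ = 1 := by
    have := G.ncard_arc_changes (ho₀.trans ho₁.symm) φ Y hφY
    rw [hYa, hφc] at this
    have key : ∀ z : ZMod 2, ((1 : ℕ) : ZMod 2) = 0 - z → z = 1 := by decide
    exact key _ this
  refine ⟨φ, ⟨?_, ?_, ?_, hedge, ?_⟩, ?_, ?_⟩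
  · exact fun d hd => (G.eq_of_tail_eq hφX hX0 hc₀ hd).trans hφc
  · exact fun d hd => (G.eq_of_tail_eq hφX hX1 hc₁ hd).trans hφ1
  · intro d h0 h1
    rw [twoIntervals_rot_iff]
    simp only [← hφX]
    exact hX.outdeg_eq _ h0 h1
  · intro d
    rw [twoIntervals_faceNext_iff]
    simp only [← hφY]
    exact hYf _
  · ext d
    rw [G.mem_inducedOrientation_iff hedge, hφX]
  · ext d
    rw [G.mem_inducedDualOrientation_iff hedge, hφY]

end PlaneGraph

theorem mainTheorem5 {D : Type*} [Finite D] (G : PlaneGraph D)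
    (outer : G.Face) (s₀ s₁ : G.Vertex) (hs : s₀ ≠ s₁)
    (c₀ c₁ : D) (hc₀ : G.tail c₀ = s₀) (hc₁ : G.tail c₁ = s₁)
    (ho₀ : G.left c₀ = outer) (ho₁ : G.left c₁ = outer) :
    Set.BijOn (fun φ : D → Fin 2 => (G.inducedOrientation φ, G.inducedDualOrientation φ))
      {φ | G.IsWeakLabeling s₀ s₁ φ}
      ({X | G.IsTwoOrientation s₀ s₁ X} ×ˢ {Y | G.IsTwoStarOrientation outer c₀ c₁ Y}) := by
  refine ⟨fun φ hφ => ⟨hφ.isTwoOrientation, hφ.isTwoStarOrientation G hc₀ hc₁ ho₀ ho₁⟩, ?_, ?_⟩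
  · intro φ hφ ψ hψ h
    obtain ⟨hX, hY⟩ := Prod.mk.inj h
    refine G.eq_of_changes_iff (c := c₀)
      ((hφ.special₀ c₀ hc₀).trans (hψ.special₀ c₀ hc₀).symm) (fun d => ?_) (fun d => ?_)
    · rw [← G.mem_inducedOrientation_iff hφ.edge_rule, hX,
        G.mem_inducedOrientation_iff hψ.edge_rule]
    · rw [← G.mem_inducedDualOrientation_iff hφ.edge_rule, hY,
        G.mem_inducedDualOrientation_iff hψ.edge_rule]
  · rintro ⟨X, Y⟩ ⟨hX, hY⟩
    obtain ⟨φ, hφ, rfl, rfl⟩ := G.exists_isWeakLabeling hs hc₀ hc₁ ho₀ ho₁ hX hY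
    exact ⟨φ, hφ, rfl⟩
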